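/- There is an absolute constant $C>0$ such that the following holds for every integer $d\ge 1$ and every finite set $U\subseteq\mathbb{R}^d$ with $|U|=n$. Let $\mathrm{PromiseCSD}_U:2^U\times 2^U\to\{0,1\}$ be the partial function that takes the value $0$ at $(X,Y)$ if $X\cap Y\neq\emptyset$, takes the value $1$ if $\mathrm{conv}(X)\cap\mathrm{conv}(Y)=\emptyset$, and is undefined otherwise. Then there is a deterministic two-party communication protocol (in Yao's model; Alice holds $X\subseteq U$ and Bob holds $Y\subseteq U$) that exchanges at most $$C\cdot d\cdot \log(\max\{d,2\})\cdot\log(\max\{n,2\})$$ bits on every input and outputs a bit together with a function $h:U\to\{\pm1\}$, such that 1. the output bit equals $\mathrm{PromiseCSD}_U(X,Y)$ whenever the latter is defined; in particular the deterministic communication complexity satisfies $D(\mathrm{PromiseCSD}_U)\le C\, d\log(\max\{d,2\})\log(\max\{n,2\})$, that is, $D(\mathrm{PromiseCSD}_U)=O(d\log d\log n)$ for $d,n\ge 2$; 2. for all $X,Y\subseteq U$ with $\mathrm{conv}(X)\cap\mathrm{conv}(Y)=\emptyset$, the output function $h$ satisfies $X\subseteq h^{-1}(-1)$ and $Y\subseteq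 h^{-1}(+1)$. (When the output bit is $0$, the function $h$ carries no meaning.) -/

import Mathlib

namespace CommComplexity

/-- A deterministic two-party communication protocol in Yao's model, as a binary tree. Alice holds
an input in `A`, Bob holds an input in `B`. A node `alice f p q` is owned by Alice: she sends
the bit `f x`, which may depend on her input (and on the node, i.e. on the transcript so far), and
the parties continue with `p` if the bit is `false` and with `q` if it is `true`; similarly for
`bob`. A leaf carries the output, which both parties know. -/
inductive Protocol (A B Z : Type*) where
  | leaf (z : Z) : Protocol A B Z
  | alice (f : A → Bool) (p q : Protocol A B Z) : Protocol A B Z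
  | bob (g : B → Bool) (p q : Protocol A B Z) : Protocol A B Z

namespace Protocol

variable {A B Z W : Type*}

/-- The output of the protocol on the input pair `(x, y)`. -/
def run : Protocol A B Z → A → B → Z
  | leaf z, _, _ => z
  | alice f p q, x, y => if f x then q.run x y else p.run x y
  | bob g p q, x, y => if g y then q.run x y else p.run x y

/-- The worst-case number of bits exchanged: the height of the tree. -/
def cost : Protocol A B Z → ℕ
  | leaf _ => 0
  | alice _ p q => max p.cost q.cost + 1
  | bob _ p q => max p.cost q.cost + 1

/-- The same communication, with a function applied to the output. -/
def map (φ : Z → W) : Protocol A B Z → Protocol A B W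
  | leaf z => leaf (φ z)
  | alice f p q => alice f (p.map φ) (q.map φ)
  | bob g p q => bob g (p.map φ) (q.map φ)

/-- The protocol computes the partial function `f` (`none` means undefined): its output is correct
on the domain of `f`, and unrestricted elsewhere. -/
def Computes (P : Protocol A B Z) (f : A → B → Option Z) : Prop :=
  ∀ x y z, f x y = some z → P.run x y = z

end Protocol

/-- Deterministic communication complexity `D(f)` of a partial function: the least cost of a
protocol computing it (`⊤` if there is none). -/
noncomputable def detCC {A B Z : Type*} (f : A → B → Option Z) : ℕ∞ :=
  ⨅ (P : Protocol A B Z) (_ : P.Computes f), (P.cost : ℕ∞)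

/-- The convex hull in `ℝ^d` of a subset `X` of the finite domain `U ⊆ ℝ^d`. -/
def conv {d : ℕ} {U : Finset (EuclideanSpace ℝ (Fin d))} (X : Set U) :
    Set (EuclideanSpace ℝ (Fin d)) :=
  convexHull ℝ (Subtype.val '' X)

open Classical in
/-- The partial function `PromiseCSD_U : 2^U × 2^U → {0, 1}`: it is `0` if `X ∩ Y ≠ ∅`, it is `1`
if `conv X ∩ conv Y = ∅`, and it is undefined otherwise. -/
noncomputable def promiseCSD {d : ℕ} (U : Finset (EuclideanSpace ℝ (Fin d))) (X Y : Set U) :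
    Option (Fin 2) :=
  if (X ∩ Y).Nonempty then some 0
  else if conv X ∩ conv Y = ∅ then some 1
  else none

end CommComplexity

/-! Put D = d + 1. Points of `U` act as linear functionals on the D-dimensional space of affine
functions, so a separating hyperplane is a vector `w` there. The geometric core is
`exists_containers`: poly(d)^O(d) sets, a number independent of `n`, such that for every `w` one of
them lies in the closed halfspace and misses at most a quarter of all points from the open one.

To build them, sample poly(d) points and cut the cube by their hyperplanes. By
`exists_mem_convexHull_flagVerts`, `w` is a convex combination of D + 1 vertices of its cell, chosen
along a flag of faces. The container consists of the points nonnegative at these vertices; a point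
positive at `w` is left out only if its hyperplane separates two of them. No sample point does that,
and the vertices are determined by D(D + 1) hyperplanes, so a union bound (`exists_sample`) gives a
sample for which such points are at most a quarter. Sauer–Shelah counts the cells; lists of D
inequalities count the flags.

If the hulls are disjoint, `w` or `-w` is positive on at least half of the surviving points, so some
container with a quarter of them misses `X` or `Y`. A player names it, and it is labelled and
removed: O(log n) rounds of O(d log d) bits. A common point of `X` and `Y` is never removed, and if
neither player can name a container, the hulls meet. -/

namespace PolytopeFlag

/-! ### Vertices and flags of faces of a polytope. -/

open Set

variable {E ι : Type*} [NormedAddCommGroup E] [NormedSpace ℝ E]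

/-- The polytope cut out by the inequalities `c i ≤ a i w`. -/
def polytope (a : ι → Module.Dual ℝ E) (c : ι → ℝ) : Set E := {w | ∀ i, c i ≤ a i w}

/-- The face of `polytope a c` on which the inequalities indexed by `S` are tight. -/
def face (a : ι → Module.Dual ℝ E) (c : ι → ℝ) (S : Set ι) : Set E :=
  {w | w ∈ polytope a c ∧ ∀ i ∈ S, a i w = c i}

/-- Inequalities slack at `v` stay valid for small moves along `±u`, and the tight ones do not
change, so `v` would be the midpoint of a segment in the face. -/
theorem eq_zero_of_tight [Finite ι] {a : ι → Module.Dual ℝ E} {c : ι → ℝ} {S : Set ι} {v : E}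
    (hv : v ∈ (face a c S).extremePoints ℝ) {u : E} (hu : ∀ i, a i v = c i → a i u = 0) : u = 0 := by
  obtain ⟨⟨hvP, hvS⟩, hext⟩ := mem_extremePoints.1 hv
  have key : ∀ᶠ ε in nhdsWithin (0 : ℝ) (Ioi 0),
      ∀ i, c i ≤ a i (v + ε • u) ∧ c i ≤ a i (v - ε • u) := by
    rw [Filter.eventually_all]
    intro i
    by_cases hi : a i v = c i
    · refine Filter.Eventually.of_forall fun ε => ?_
      simp [hu i hi, hi]
    · have hlt : c i < a i v := lt_of_le_of_ne (hvP i) (Ne.symm hi)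
      apply Filter.Eventually.filter_mono nhdsWithin_le_nhds
      have h1 : Filter.Tendsto (fun ε : ℝ => a i v + ε * a i u) (nhds 0) (nhds (a i v)) := by
        have : Continuous fun ε : ℝ => a i v + ε * a i u := by fun_prop
        simpa using this.tendsto 0
      have h2 : Filter.Tendsto (fun ε : ℝ => a i v - ε * a i u) (nhds 0) (nhds (a i v)) := by
        have : Continuous fun ε : ℝ => a i v - ε * a i u := by fun_prop
        simpa using this.tendsto 0
      filter_upwards [h1.eventually_const_lt hlt, h2.eventually_const_lt hlt] with ε e1 e2
      simp only [map_add, map_sub, map_smul, smul_eq_mul]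
      exact ⟨e1.le, e2.le⟩
  obtain ⟨ε, hε, hpos⟩ := (key.and self_mem_nhdsWithin).exists
  have m1 : v + ε • u ∈ face a c S := ⟨fun i => (hε i).1, fun i hi => by
    simp [hu i (hvS i hi), hvS i hi]⟩
  have m2 : v - ε • u ∈ face a c S := ⟨fun i => (hε i).2, fun i hi => by
    simp [hu i (hvS i hi), hvS i hi]⟩
  have h := hext _ m1 _ m2 ⟨1/2, 1/2, by norm_num, by norm_num, by norm_num, by module⟩
  have : ε • u = 0 := by simpa using h.1
  exact (smul_eq_zero.1 this).resolve_left (ne_of_gt hpos)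

theorem apply_eq_zero_of_mem_span {b : Set (Module.Dual ℝ E)} {u : E} (hu : ∀ f ∈ b, f u = 0)
    {f : Module.Dual ℝ E} (hf : f ∈ Submodule.span ℝ b) : f u = 0 := by
  induction hf using Submodule.span_induction with
  | mem x h => exact hu x h
  | zero => rfl
  | add x y _ _ hx hy => simp only [LinearMap.add_apply, hx, hy, add_zero]
  | smul r x _ hx => simp only [LinearMap.smul_apply, hx, smul_zero]

/-- A family of functionals with trivial common kernel contains `finrank ℝ E` functionals with
trivial common kernel. -/
theorem exists_fin_forall_eq_zero [FiniteDimensional ℝ E] (a : ι → Module.Dual ℝ E) (T : Set ι)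
    (hT : ∀ u, (∀ i ∈ T, a i u = 0) → u = 0) :
    ∃ τ : Fin (Module.finrank ℝ E) → ι, (∀ j, τ j ∈ T) ∧ ∀ u, (∀ j, a (τ j) u = 0) → u = 0 := by
  obtain ⟨b, hb, hspan, hli⟩ := exists_linearIndependent ℝ (a '' T)
  have hker : ∀ u, (∀ f ∈ b, f u = 0) → u = 0 := by
    intro u hu
    apply hT
    intro i hi
    exact apply_eq_zero_of_mem_span hu (hspan ▸ Submodule.subset_span ⟨i, hi, rfl⟩)
  have htop : Submodule.span ℝ b = ⊤ := by
    rw [← Subspace.dualCoannihilator_dualAnnihilator_eq (W := Submodule.span ℝ b)]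
    have : (Submodule.span ℝ b).dualCoannihilator = ⊥ := by
      rw [eq_bot_iff]
      intro u hu
      rw [Submodule.mem_dualCoannihilator] at hu
      exact hker u fun f hf => hu f (Submodule.subset_span hf)
    rw [this, Submodule.dualAnnihilator_bot]
  let B := Module.Basis.mk hli (by simp [htop])
  have : Fintype b := FiniteDimensional.fintypeBasisIndex B
  have hcard : Fintype.card b = Module.finrank ℝ E := by
    rw [← Module.finrank_eq_card_basis B, Subspace.dual_finrank_eq]
  let e := (Fintype.equivFinOfCardEq hcard).symm
  choose g hg using fun f : b => hb f.2
  refine ⟨fun j => g (e j), fun j => (hg _).1, fun u hu => hker u fun f hf => ?_⟩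
  have := hu (e.symm ⟨f, hf⟩)
  simpa [(hg _).2] using this

/-- `v` is a point of the polytope which is determined by `finrank ℝ E` tight inequalities. -/
def IsVertex (a : ι → Module.Dual ℝ E) (c : ι → ℝ) (v : E) : Prop :=
  v ∈ polytope a c ∧ ∃ τ : Fin (Module.finrank ℝ E) → ι, (∀ j, a (τ j) v = c (τ j)) ∧
    ∀ u, (∀ j, a (τ j) u = 0) → u = 0

theorem isVertex_of_mem_extremePoints [FiniteDimensional ℝ E] [Finite ι] {a : ι → Module.Dual ℝ E} {c : ι → ℝ} {S : Set ι} {v : E}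
    (hv : v ∈ (face a c S).extremePoints ℝ) : IsVertex a c v :=
  ⟨hv.1.1, exists_fin_forall_eq_zero a {i | a i v = c i} fun _ hu => eq_zero_of_tight hv hu⟩

open Classical in
/-- A chosen extreme point of a face. -/
noncomputable def vert (a : ι → Module.Dual ℝ E) (c : ι → ℝ) (S : Set ι) : E :=
  if h : ((face a c S).extremePoints ℝ).Nonempty then h.some else 0

theorem isClosed_face [FiniteDimensional ℝ E] (a : ι → Module.Dual ℝ E) (c : ι → ℝ) (S : Set ι) :
    IsClosed (face a c S) := by
  have ha : ∀ i, Continuous (a i) := fun i => (a i).continuous_of_finiteDimensional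
  have h1 : face a c S = (⋂ i, {w | c i ≤ a i w}) ∩ ⋂ i ∈ S, {w | a i w = c i} := by
    ext w; simp [face, polytope]
  rw [h1]
  exact (isClosed_iInter fun i => isClosed_le continuous_const (ha i)).inter
    (isClosed_biInter fun i _ => isClosed_eq (ha i) continuous_const)

theorem vert_mem_extremePoints [FiniteDimensional ℝ E] {a : ι → Module.Dual ℝ E} {c : ι → ℝ}
    (hP : IsCompact (polytope a c)) {S : Set ι} (hS : (face a c S).Nonempty) :
    vert a c S ∈ (face a c S).extremePoints ℝ := by
  have hc : IsCompact (face a c S) :=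
    hP.of_isClosed_subset (isClosed_face a c S) fun w hw => hw.1
  have h := hc.extremePoints_nonempty hS
  rw [vert, dif_pos h]
  exact h.some_mem

/-- The chosen vertices of the decreasing sequence of faces obtained from `S` by making the
inequalities of a list tight one after the other. -/
noncomputable def flagVerts (a : ι → Module.Dual ℝ E) (c : ι → ℝ) : List ι → Set ι → List E
  | [], S => [vert a c S]
  | i :: l, S => vert a c S :: flagVerts a c l (insert i S)

theorem length_flagVerts (a : ι → Module.Dual ℝ E) (c : ι → ℝ) (l : List ι) (S : Set ι) :
    (flagVerts a c l S).length = l.length + 1 := by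
  induction l generalizing S with
  | nil => rfl
  | cons i l ih => simp [flagVerts, ih]

/-- The last face lies in all the earlier ones, so its nonemptiness keeps `vert` from taking its
default value anywhere along the flag. -/
theorem isVertex_of_mem_flagVerts [FiniteDimensional ℝ E] [Finite ι] {a : ι → Module.Dual ℝ E} {c : ι → ℝ}
    (hP : IsCompact (polytope a c)) {l : List ι} {S : Set ι}
    (hne : (face a c (S ∪ {i | i ∈ l})).Nonempty) {v : E} (hv : v ∈ flagVerts a c l S) :
    IsVertex a c v := by
  have hS : (face a c S).Nonempty := hne.mono fun w hw => ⟨hw.1, fun i hi => hw.2 i (Or.inl hi)⟩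
  induction l generalizing S with
  | nil =>
    simp only [flagVerts, List.mem_singleton] at hv
    exact hv ▸ isVertex_of_mem_extremePoints (vert_mem_extremePoints hP hS)
  | cons i l ih =>
    simp only [flagVerts, List.mem_cons] at hv
    rcases hv with rfl | hv
    · exact isVertex_of_mem_extremePoints (vert_mem_extremePoints hP hS)
    · have h' : (face a c (insert i S ∪ {j | j ∈ l})).Nonempty := by
        convert hne using 2
        ext j
        simp only [mem_union, mem_insert_iff, mem_ofPred_eq, List.mem_cons]
        tauto
      exact ih h' hv (h'.mono fun w hw => ⟨hw.1, fun i hi => hw.2 i (Or.inl hi)⟩)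

/-- A ray inside a polytope without recession directions leaves it through a facet. -/
theorem exists_exit [Fintype ι] {a : ι → Module.Dual ℝ E} {c : ι → ℝ}
    (hrec : ∀ u, (∀ i, 0 ≤ a i u) → u = 0) {v w : E} (hv : v ∈ polytope a c)
    (hw : w ∈ polytope a c) (hne : w ≠ v) :
    ∃ t : ℝ, 1 ≤ t ∧ v + t • (w - v) ∈ polytope a c ∧
      ∃ i, a i (v + t • (w - v)) = c i ∧ a i (w - v) < 0 := by
  classical
  have hex : (Finset.univ.filter fun i => a i (w - v) < 0).Nonempty := by
    by_contra h
    rw [Finset.not_nonempty_iff_eq_empty, Finset.filter_eq_empty_iff] at h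
    exact hne (sub_eq_zero.1 (hrec _ fun i => not_lt.1 (h (Finset.mem_univ i))))
  -- Ratio test: among the inequalities decreasing along the ray, take the one that becomes tight
  -- first.
  obtain ⟨i, hi, hmin⟩ := Finset.exists_min_image _ (fun i => (c i - a i v) / a i (w - v)) hex
  simp only [Finset.mem_filter, Finset.mem_univ, true_and] at hi hmin
  refine ⟨(c i - a i v) / a i (w - v), ?_, fun j => ?_, i, ?_, hi⟩
  · rw [le_div_iff_of_neg hi]
    have := hw i
    simp only [map_sub]
    linarith
  · have h1 : 1 ≤ (c i - a i v) / a i (w - v) := by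
      rw [le_div_iff_of_neg hi]
      have := hw i
      simp only [map_sub]
      linarith
    rw [map_add, map_smul, smul_eq_mul]
    rcases lt_or_ge (a j (w - v)) 0 with hj | hj
    · have := hmin j hj
      rw [le_div_iff_of_neg hj] at this
      linarith
    · have := hv j
      have := mul_nonneg (zero_le_one.trans h1) hj
      linarith
  · rw [map_add, map_smul, smul_eq_mul, div_mul_cancel₀ _ hi.ne]
    ring

/-- The ray from the chosen vertex `v` of the face through `w` exits at some `w'` in a smaller face;
`w` lies between `v` and `w'`, and induction on the dimension handles `w'`. The vertices depend only
on the list of inequalities, not on `w`, so counting lists counts flags. -/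
theorem exists_mem_convexHull_flagVerts [FiniteDimensional ℝ E] [Fintype ι] {a : ι → Module.Dual ℝ E} {c : ι → ℝ}
    (hP : IsCompact (polytope a c)) (hrec : ∀ u, (∀ i, 0 ≤ a i u) → u = 0) {i₀ : ι}
    (h₀ : a i₀ = 0) (hc₀ : c i₀ = 0) (r : ℕ) (S : Set ι) (w : E) (hw : w ∈ face a c S)
    (hr : Module.finrank ℝ (Submodule.span ℝ (a '' S)).dualCoannihilator ≤ r) :
    ∃ l : List ι, l.length = r ∧ (face a c (S ∪ {i | i ∈ l})).Nonempty ∧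
      w ∈ convexHull ℝ {x | x ∈ flagVerts a c l S} := by
  induction r generalizing S w with
  | zero =>
    have hv := (vert_mem_extremePoints hP ⟨w, hw⟩).1
    refine ⟨[], rfl, by simpa using ⟨w, hw⟩, ?_⟩
    have hbot := Submodule.finrank_eq_zero.1 (Nat.le_zero.1 hr)
    have hmem : w - vert a c S ∈ (Submodule.span ℝ (a '' S)).dualCoannihilator := by
      rw [Submodule.mem_dualCoannihilator]
      intro f hf
      refine apply_eq_zero_of_mem_span ?_ hf
      rintro _ ⟨j, hj, rfl⟩
      simp [hw.2 j hj, hv.2 j hj]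
    rw [hbot, Submodule.mem_bot, sub_eq_zero] at hmem
    apply subset_convexHull
    simp [flagVerts, hmem]
  | succ r ih =>
    have hv := (vert_mem_extremePoints hP ⟨w, hw⟩).1
    by_cases hwv : w = vert a c S
    -- The trivial inequality `i₀` pads the list to length exactly `r + 1` without shrinking the
    -- face.
    · refine ⟨i₀ :: List.replicate r i₀, by simp, ⟨w, hw.1, ?_⟩, ?_⟩
      · rintro i (hi | hi)
        · exact hw.2 i hi
        · have : i = i₀ := by
            simp only [mem_ofPred_eq, List.mem_cons, List.mem_replicate] at hi
            tauto
          simp [this, h₀, hc₀]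
      · apply subset_convexHull
        simp [flagVerts, ← hwv]
    · obtain ⟨t, ht, hmem, i, hi, hneg⟩ := exists_exit hrec hv.1 hw.1 hwv
      set v := vert a c S with hvdef
      set w' := v + t • (w - v) with hw'
      have hface : w' ∈ face a c (insert i S) := by
        refine ⟨hmem, fun j hj => ?_⟩
        rcases hj with rfl | hj
        · exact hi
        · simp [hw', hv.2 j hj, hw.2 j hj]
      have hlt : (Submodule.span ℝ (a '' insert i S)).dualCoannihilator <
          (Submodule.span ℝ (a '' S)).dualCoannihilator := by
        refine lt_of_le_of_ne (Submodule.dualCoannihilator_anti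
          (Submodule.span_mono (image_mono (subset_insert i S)))) fun heq => ?_
        -- The direction `w - v` is killed by all of `S` but not by `a i`, so the dimension drops
        -- strictly.
        have hm : w - v ∈ (Submodule.span ℝ (a '' S)).dualCoannihilator := by
          rw [Submodule.mem_dualCoannihilator]
          intro f hf
          refine apply_eq_zero_of_mem_span ?_ hf
          rintro _ ⟨j, hj, rfl⟩
          simp [hw.2 j hj, hv.2 j hj]
        rw [← heq, Submodule.mem_dualCoannihilator] at hm
        exact hneg.ne (hm _ (Submodule.subset_span ⟨i, mem_insert _ _, rfl⟩))
      obtain ⟨l, hl, hne, hconv⟩ := ih (insert i S) w' hface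
        (Nat.le_of_lt_succ ((Submodule.finrank_lt_finrank_of_lt hlt).trans_le hr))
      refine ⟨i :: l, by simp [hl], ?_, ?_⟩
      · convert hne using 2
        ext j
        simp only [mem_union, mem_insert_iff, mem_ofPred_eq, List.mem_cons]
        tauto
      · have hv' : v ∈ convexHull ℝ {x | x ∈ flagVerts a c (i :: l) S} :=
          subset_convexHull _ _ (by simp [flagVerts, hvdef])
        have hw'' : w' ∈ convexHull ℝ {x | x ∈ flagVerts a c (i :: l) S} :=
          convexHull_mono (fun x hx => by simp [flagVerts, show x ∈ flagVerts a c l (insert i S)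
            from hx]) hconv
        have htpos : 0 < t := by linarith
        have hseg : w = (1 - t⁻¹) • v + t⁻¹ • w' := by
          rw [hw', smul_add, smul_smul, inv_mul_cancel₀ htpos.ne', one_smul, sub_smul, one_smul]
          abel
        rw [hseg]
        exact convex_convexHull ℝ _ hv' hw'' (sub_nonneg.2 (inv_le_one_of_one_le₀ ht))
          (inv_nonneg.2 htpos.le) (by ring)

end PolytopeFlag

/-! ### Sampling nets by a union bound. -/

namespace SampleCompression

open Finset

variable {α T : Type*} [Fintype α] [DecidableEq α] {m K : ℕ}

/-- If the bad set `B a` depends only on the sample points with index in `R`, then few samples avoid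
their own bad set although it is large. -/
theorem card_filter_avoid_le (R : Finset (Fin m)) (B : (Fin m → α) → Finset α)
    (hB : ∀ a a', (∀ i ∈ R, a i = a' i) → B a = B a') (hR : #R ≤ K) (hK : K ≤ m) :
    4 ^ (m - K) * #{a : Fin m → α | (∀ i, a i ∉ B a) ∧ Fintype.card α < 4 * #(B a)} ≤
      3 ^ (m - K) * Fintype.card α ^ m := by
  classical
  set n := Fintype.card α with hn
  set S : Finset (Fin m → α) := {a | (∀ i, a i ∉ B a) ∧ n < 4 * #(B a)} with hS
  -- Fixing the coordinates in `R` fixes the bad set; each other coordinate must then fall in its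
  -- complement, which holds at most 3/4 of the points.
  have hfib : ∀ b : R → α, 4 ^ (m - K) * #{a ∈ S | (fun i : R => a i) = b} ≤
      3 ^ (m - K) * n ^ (m - #R) := by
    intro b
    rcases Finset.eq_empty_or_nonempty {a ∈ S | (fun i : R => a i) = b} with h0 | ⟨a₀, ha₀⟩
    · simp [h0]
    simp only [hS, mem_filter, mem_univ, true_and] at ha₀
    obtain ⟨⟨_, hbig⟩, hb⟩ := ha₀
    have hsub : {a ∈ S | (fun i : R => a i) = b} ⊆
        Fintype.piFinset fun i => if i ∈ R then {a₀ i} else (B a₀)ᶜ := by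
      intro a ha
      simp only [hS, mem_filter, mem_univ, true_and] at ha
      rw [Fintype.mem_piFinset]
      have hagree : ∀ i ∈ R, a i = a₀ i := fun i hi =>
        congrFun (ha.2.trans hb.symm) ⟨i, hi⟩
      intro i
      split_ifs with hi
      · exact mem_singleton.2 (hagree i hi)
      · rw [mem_compl, ← hB a a₀ hagree]
        exact ha.1.1 i
    have hcard : #(Fintype.piFinset fun i => if i ∈ R then {a₀ i} else (B a₀)ᶜ) =
        (#(B a₀)ᶜ) ^ (m - #R) := by
      rw [Fintype.card_piFinset]
      have : ∀ i, #(if i ∈ R then {a₀ i} else (B a₀)ᶜ) = if i ∈ R then 1 else #(B a₀)ᶜ := by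
        intro i; split_ifs <;> simp
      simp only [this]
      rw [prod_ite, prod_const_one, one_mul, prod_const]
      congr 1
      rw [← compl_filter, card_compl, Fintype.card_fin]
      simp
    have hc : 4 * #(B a₀)ᶜ ≤ 3 * n := by
      rw [card_compl]; omega
    have hcn : #(B a₀)ᶜ ≤ n := card_le_univ _
    have hsplit : m - #R = (m - K) + (K - #R) := by omega
    calc 4 ^ (m - K) * #{a ∈ S | (fun i : R => a i) = b}
        ≤ 4 ^ (m - K) * (#(B a₀)ᶜ) ^ (m - #R) := by
          gcongr; exact hcard ▸ card_le_card hsub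
      _ = (4 * #(B a₀)ᶜ) ^ (m - K) * (#(B a₀)ᶜ) ^ (K - #R) := by
          rw [hsplit, pow_add, mul_pow]; ring
      _ ≤ (3 * n) ^ (m - K) * n ^ (K - #R) := by gcongr
      _ = 3 ^ (m - K) * n ^ (m - #R) := by rw [hsplit, pow_add, mul_pow]; ring
  have hsum : #S = ∑ b : R → α, #{a ∈ S | (fun i : R => a i) = b} :=
    card_eq_sum_card_fiberwise fun _ _ => mem_univ _
  rw [hsum, mul_sum]
  calc ∑ b : R → α, 4 ^ (m - K) * #{a ∈ S | (fun i : R => a i) = b}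
      ≤ ∑ b : R → α, 3 ^ (m - K) * n ^ (m - #R) := sum_le_sum fun b _ => hfib b
    _ = 3 ^ (m - K) * n ^ m := by
      have hRm : #R ≤ m := hR.trans hK
      rw [sum_const, card_univ, Fintype.card_fun, Fintype.card_coe, smul_eq_mul, ← hn]
      have hsplit : n ^ m = n ^ #R * n ^ (m - #R) := by rw [← pow_add, Nat.add_sub_cancel' hRm]
      rw [hsplit]; ring

/-- A sample which is a net for all bad sets spanned by few of its own points. -/
theorem exists_sample [Fintype T] [Nonempty α] (R : T → Finset (Fin m))
    (B : T → (Fin m → α) → Finset α)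
    (hB : ∀ t a a', (∀ i ∈ R t, a i = a' i) → B t a = B t a') (hR : ∀ t, #(R t) ≤ K) (hK : K ≤ m)
    (hT : Fintype.card T * 3 ^ (m - K) < 4 ^ (m - K)) :
    ∃ a : Fin m → α, ∀ t, (∀ i, a i ∉ B t a) → 4 * #(B t a) ≤ Fintype.card α := by
  classical
  by_contra! hcon
  set n := Fintype.card α with hn
  have hcover : (univ : Finset (Fin m → α)) ⊆
      univ.biUnion fun t => {a : Fin m → α | (∀ i, a i ∉ B t a) ∧ n < 4 * #(B t a)} := by
    intro a _
    obtain ⟨t, ht⟩ := hcon a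
    simp only [mem_biUnion, mem_univ, mem_filter, true_and]
    exact ⟨t, ht⟩
  have h1 : n ^ m ≤ ∑ t, #{a : Fin m → α | (∀ i, a i ∉ B t a) ∧ n < 4 * #(B t a)} := by
    have := (card_le_card hcover).trans card_biUnion_le
    simpa [card_univ, hn] using this
  have hpos : 0 < n ^ m := pow_pos Fintype.card_pos m
  have h2 : 4 ^ (m - K) * n ^ m ≤ Fintype.card T * 3 ^ (m - K) * n ^ m := by
    calc 4 ^ (m - K) * n ^ m ≤
        ∑ t, 4 ^ (m - K) * #{a : Fin m → α | (∀ i, a i ∉ B t a) ∧ n < 4 * #(B t a)} := by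
          rw [← mul_sum]; gcongr
      _ ≤ ∑ _t : T, 3 ^ (m - K) * n ^ m :=
          sum_le_sum fun t _ => card_filter_avoid_le (R t) (B t) (hB t) (hR t) hK
      _ = _ := by rw [sum_const, card_univ, smul_eq_mul]; ring
  exact absurd (Nat.le_of_mul_le_mul_right h2 hpos) (not_le.2 hT)

end SampleCompression

/-! ### Counting the cells of an arrangement by VC dimension. -/

namespace PolytopeFlag

open Finset

variable {E : Type*} [AddCommGroup E] [Module ℝ E] [FiniteDimensional ℝ E] {m : ℕ}

open Classical in
/-- The subsets of a family of functionals which are the positive part at some point. -/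
noncomputable def positiveParts (p : Fin m → Module.Dual ℝ E) : Finset (Finset (Fin m)) :=
  {s | ∃ w, s = ({i | 0 < p i w} : Finset (Fin m))}

/-- More functionals than the dimension satisfy a linear relation, with some coefficient positive
after a change of sign. Shattering gives a point where exactly the functionals with positive
coefficient are positive, and there the relation has a positive value. -/
theorem card_le_finrank_of_shatters (p : Fin m → Module.Dual ℝ E) {s : Finset (Fin m)}
    (hs : (positiveParts p).Shatters s) : #s ≤ Module.finrank ℝ E := by
  classical
  by_contra! hlt
  have hli : ¬ LinearIndependent ℝ fun i : s => p i := fun h => by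
    have := h.fintype_card_le_finrank
    rw [Subspace.dual_finrank_eq, Fintype.card_coe] at this
    omega
  obtain ⟨g, hg, i, hi⟩ := Fintype.not_linearIndependent_iff.1 hli
  have key : ∀ g : s → ℝ, (∀ w, ∑ i, g i * p i w = 0) → ∀ i, ¬ 0 < g i := by
    intro g hg i hi
    obtain ⟨t, ht, hst⟩ := hs (t := s.filter fun j => ∃ h : j ∈ s, 0 < g ⟨j, h⟩) (filter_subset _ _)
    simp only [positiveParts, mem_filter, mem_univ, true_and] at ht
    obtain ⟨w, rfl⟩ := ht
    have hiff : ∀ j : s, 0 < p j w ↔ 0 < g j := by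
      intro j
      have := Finset.ext_iff.1 hst j
      simpa using this
    have hpos : 0 < ∑ j, g j * p j w := by
      refine sum_pos' (fun j _ => ?_) ⟨i, mem_univ _, mul_pos hi ((hiff i).2 hi)⟩
      rcases lt_or_ge 0 (g j) with h | h
      · exact (mul_pos h ((hiff j).2 h)).le
      · exact mul_nonneg_of_nonpos_of_nonpos h (not_lt.1 fun h' => not_lt.2 h ((hiff j).1 h'))
    exact hpos.ne' (hg w)
  have hg' : ∀ w, ∑ j, g j * p j w = 0 := fun w => by simpa using LinearMap.congr_fun hg w
  rcases lt_or_gt_of_ne hi with h | h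
  · exact key (-g) (fun w => by simpa using hg' w) i (by simpa using h)
  · exact key g hg' i h

theorem card_positiveParts_le (p : Fin m → Module.Dual ℝ E) :
    #(positiveParts p) ≤ (m + 1) ^ Module.finrank ℝ E := by
  classical
  set D := Module.finrank ℝ E
  have hvc : (positiveParts p).vcDim ≤ D := Finset.sup_le fun s hs =>
    card_le_finrank_of_shatters p (mem_shatterer.1 hs)
  calc #(positiveParts p) ≤ #(positiveParts p).shatterer := card_le_card_shatterer _
    _ ≤ ∑ k ∈ Iic (positiveParts p).vcDim, (Fintype.card (Fin m)).choose k :=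
      card_shatterer_le_sum_vcDim
    _ ≤ ∑ k ∈ range (D + 1), m.choose k := by
      rw [Fintype.card_fin]
      refine sum_le_sum_of_subset fun k hk => ?_
      rw [mem_Iic] at hk
      exact mem_range.2 (by omega)
    _ ≤ ∑ k ∈ range (D + 1), m ^ k * 1 ^ (D - k) * D.choose k := by
      refine sum_le_sum fun k hk => ?_
      have h1 : 1 ≤ D.choose k := Nat.choose_pos (by have := mem_range.1 hk; omega)
      rw [one_pow, mul_one]
      exact (Nat.choose_le_pow m k).trans (Nat.le_mul_of_pos_right _ h1)
    _ = (m + 1) ^ D := (add_pow m 1 D).symm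

end PolytopeFlag

/-! ### Cells in the cube and containers for halfspaces. -/

namespace PolytopeFlag

open Finset

variable {D m : ℕ}

/-- The functionals of the inequalities describing the cube `[-1, 1]^D`, and a trivial one. -/
noncomputable def cubeFun : Option (Fin D × Bool) → Module.Dual ℝ (Fin D → ℝ)
  | none => 0
  | some (k, true) => LinearMap.proj k
  | some (k, false) => -LinearMap.proj k

/-- The right hand sides of the inequalities describing the cube `[-1, 1]^D`. -/
def cubeRhs : Option (Fin D × Bool) → ℝ
  | none => 0
  | some _ => -1

/-- The equations of the hyperplanes spanned by a family of functionals and of those bounding the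
cube. -/
noncomputable def hyperplane (p : Fin m → Module.Dual ℝ (Fin D → ℝ)) :
    Fin m ⊕ Option (Fin D × Bool) → Module.Dual ℝ (Fin D → ℝ) × ℝ :=
  Sum.elim (fun i => (p i, 0)) fun b => (cubeFun b, cubeRhs b)

/-- The functionals whose inequalities define the cell with positive part `s` of a hyperplane
arrangement in the cube. -/
noncomputable def cellFun (p : Fin m → Module.Dual ℝ (Fin D → ℝ)) (s : Finset (Fin m)) :
    Fin m ⊕ Option (Fin D × Bool) → Module.Dual ℝ (Fin D → ℝ) :=
  Sum.elim (fun i => if i ∈ s then p i else -p i) cubeFun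

/-- The right hand sides of the inequalities defining a cell. -/
def cellRhs : Fin m ⊕ Option (Fin D × Bool) → ℝ := Sum.elim (fun _ => 0) cubeRhs

theorem abs_le_one_iff_cube (w : Fin D → ℝ) :
    (∀ b, cubeRhs b ≤ cubeFun b w) ↔ ∀ k, |w k| ≤ 1 := by
  constructor
  · intro h k
    have h1 := h (some (k, true))
    have h2 := h (some (k, false))
    simp only [cubeRhs, cubeFun, LinearMap.neg_apply, LinearMap.proj_apply] at h1 h2
    exact abs_le.2 ⟨h1, by linarith⟩
  · rintro h (_ | ⟨k, _ | _⟩)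
    · simp [cubeRhs, cubeFun]
    · have := (abs_le.1 (h k)).2
      simpa [cubeRhs, cubeFun] using this
    · have := (abs_le.1 (h k)).1
      simpa [cubeRhs, cubeFun] using this

theorem mem_cell_iff (p : Fin m → Module.Dual ℝ (Fin D → ℝ)) (s : Finset (Fin m)) (w : Fin D → ℝ) :
    w ∈ polytope (cellFun p s) cellRhs ↔
      (∀ k, |w k| ≤ 1) ∧ (∀ i ∈ s, 0 ≤ p i w) ∧ ∀ i ∉ s, p i w ≤ 0 := by
  rw [← abs_le_one_iff_cube]
  simp only [polytope, Set.mem_ofPred_eq, Sum.forall, cellFun, cellRhs, Sum.elim_inl, Sum.elim_inr]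
  rw [and_comm]
  refine and_congr_right fun _ => ⟨fun h => ⟨fun i hi => ?_, fun i hi => ?_⟩, fun h i => ?_⟩
  · simpa [hi] using h i
  · simpa [hi] using h i
  · by_cases hi : i ∈ s
    · simpa [hi] using h.1 i hi
    · simpa [hi] using h.2 i hi

theorem isCompact_cell (p : Fin m → Module.Dual ℝ (Fin D → ℝ)) (s : Finset (Fin m)) :
    IsCompact (polytope (cellFun p s) cellRhs) := by
  have hclosed : IsClosed (polytope (cellFun p s) cellRhs) := by
    have := isClosed_face (cellFun p s) cellRhs ∅
    simpa [face] using this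
  refine (isCompact_Icc (a := fun _ : Fin D => (-1 : ℝ)) (b := fun _ => 1)).of_isClosed_subset
    hclosed fun w hw => ?_
  have h := ((mem_cell_iff p s w).1 hw).1
  exact ⟨fun k => (abs_le.1 (h k)).1, fun k => (abs_le.1 (h k)).2⟩

theorem eq_zero_of_cellFun_nonneg (p : Fin m → Module.Dual ℝ (Fin D → ℝ)) (s : Finset (Fin m))
    {u : Fin D → ℝ} (hu : ∀ i, 0 ≤ cellFun p s i u) : u = 0 := by
  funext k
  have h1 := hu (.inr (some (k, true)))
  have h2 := hu (.inr (some (k, false)))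
  simp only [cellFun, cubeFun, Sum.elim_inr, LinearMap.neg_apply, LinearMap.proj_apply] at h1 h2
  exact le_antisymm (neg_nonneg.1 h2) h1

open Classical in
/-- A solution of a system of linear equations. -/
noncomputable def solution {r : ℕ} (e : Fin r → Module.Dual ℝ (Fin D → ℝ) × ℝ) : Fin D → ℝ :=
  if h : ∃ v, ∀ j, (e j).1 v = (e j).2 then h.choose else 0

/-- Tightness ignores the sign of a functional, so the cell `s` drops out and a vertex is recovered
from the indices of its hyperplanes alone. -/
theorem IsVertex.exists_eq_solution {p : Fin m → Module.Dual ℝ (Fin D → ℝ)} {s : Finset (Fin m)}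
    {v : Fin D → ℝ} (hv : IsVertex (cellFun p s) cellRhs v) :
    ∃ τ : Fin (Module.finrank ℝ (Fin D → ℝ)) → Fin m ⊕ Option (Fin D × Bool),
      v = solution (hyperplane p ∘ τ) := by
  obtain ⟨-, τ, hτ, huniq⟩ := hv
  have hiff : ∀ (i : Fin m ⊕ Option (Fin D × Bool)) (u : Fin D → ℝ),
      (hyperplane p i).1 u = (hyperplane p i).2 ↔ cellFun p s i u = cellRhs i := by
    rintro (i | b) u
    · by_cases hi : i ∈ s <;> simp [hyperplane, cellFun, cellRhs, hi]
    · rfl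
  have hex : ∃ u, ∀ j, ((hyperplane p ∘ τ) j).1 u = ((hyperplane p ∘ τ) j).2 :=
    ⟨v, fun j => (hiff _ _).2 (hτ j)⟩
  refine ⟨τ, sub_eq_zero.1 (huniq _ fun j => ?_)⟩
  rw [solution, dif_pos hex, map_sub, hτ j, (hiff _ _).1 (hex.choose_spec j), sub_self]

variable {α : Type*} [Fintype α]

open Classical in
/-- The points of `α` whose hyperplanes separate two of the points `v j`. -/
noncomputable def crossing {ι : Type*} (p : α → Module.Dual ℝ (Fin D → ℝ)) (v : ι → Fin D → ℝ) :
    Finset α := {x | (∃ j, p x (v j) < 0) ∧ ∃ j, 0 < p x (v j)}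

theorem exists_pos_of_mem_convexHull {ι E : Type*} [AddCommGroup E] [Module ℝ E]
    {f : Module.Dual ℝ E} {v : ι → E} {w : E} (hw : w ∈ convexHull ℝ (Set.range v)) (h : 0 < f w) :
    ∃ j, 0 < f (v j) := by
  by_contra! hcon
  have hsub : convexHull ℝ (Set.range v) ⊆ {u | f u ≤ 0} :=
    convexHull_min (by rintro _ ⟨j, rfl⟩; exact hcon j) (convex_halfSpace_le f.isLinear 0)
  exact not_lt.2 (hsub hw) h

theorem nonneg_of_mem_convexHull {ι E : Type*} [AddCommGroup E] [Module ℝ E]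
    {f : Module.Dual ℝ E} {v : ι → E} {w : E} (hw : w ∈ convexHull ℝ (Set.range v))
    (h : ∀ j, 0 ≤ f (v j)) : 0 ≤ f w :=
  convexHull_min (t := {u | 0 ≤ f u}) (by rintro _ ⟨j, rfl⟩; exact h j)
    (convex_halfSpace_ge f.isLinear 0) hw

/-- A tuple of D + 1 vertices is encoded by (D + 1)D hyperplane indices, hence involves at most that
many sample points. Sample hyperplanes never separate vertices of one cell, so the sample avoids
every such crossing set. -/
theorem exists_net [Nonempty α] (p : α → Module.Dual ℝ (Fin D → ℝ)) (hm : (D + 1) * D ≤ m)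
    (hT : (m + 2 * D + 1) ^ ((D + 1) * D) * 3 ^ (m - (D + 1) * D) < 4 ^ (m - (D + 1) * D)) :
    ∃ a : Fin m → α, ∀ (s : Finset (Fin m)) (v : Fin (D + 1) → Fin D → ℝ),
      (∀ j, IsVertex (cellFun (p ∘ a) s) cellRhs (v j)) →
        4 * #(crossing p v) ≤ Fintype.card α := by
  classical
  let r := Module.finrank ℝ (Fin D → ℝ)
  have hr : r = D := Module.finrank_fin_fun ℝ
  obtain ⟨a, ha⟩ := SampleCompression.exists_sample (α := α) (m := m) (K := (D + 1) * D)
    (T := Fin (D + 1) → Fin r → Fin m ⊕ Option (Fin D × Bool))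
    (fun τ => {i | ∃ j l, τ j l = .inl i})
    (fun τ a => crossing p fun j => solution (hyperplane (p ∘ a) ∘ τ j))
    (by
      intro τ a a' h
      have : ∀ j, hyperplane (p ∘ a) ∘ τ j = hyperplane (p ∘ a') ∘ τ j := by
        intro j
        funext l
        rcases hτ : τ j l with i | b
        · have := h i (by simp only [mem_filter, mem_univ, true_and]; exact ⟨j, l, hτ⟩)
          simp [hyperplane, hτ, this]
        · simp [hyperplane, hτ]
      simp only [this])
    (by
      intro τ
      calc #{i | ∃ j l, τ j l = .inl i}
          ≤ #((univ : Finset (Fin (D + 1) × Fin r)).image fun x => τ x.1 x.2) := by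
            rw [← card_image_of_injective _ (Sum.inl_injective (α := Fin m)
              (β := Option (Fin D × Bool)))]
            refine card_le_card fun i hi => ?_
            simp only [mem_image, mem_filter, mem_univ, true_and] at hi ⊢
            obtain ⟨i, ⟨j, l, h⟩, rfl⟩ := hi
            exact ⟨(j, l), h⟩
        _ ≤ _ := card_image_le
        _ = (D + 1) * D := by simp [hr])
    hm
    (by
      convert hT using 2
      simp only [Fintype.card_fun, Fintype.card_fin, Fintype.card_sum, Fintype.card_option,
        Fintype.card_prod, Fintype.card_bool, hr]
      rw [← pow_mul, mul_comm D (D + 1), mul_comm D 2, add_assoc])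
  refine ⟨a, fun s v hv => ?_⟩
  choose τ hτ using fun j => (hv j).exists_eq_solution
  have hvτ : v = fun j => solution (hyperplane (p ∘ a) ∘ τ j) := funext hτ
  have := ha τ fun i hi => by
    rw [← hvτ] at hi
    simp only [crossing, mem_filter, mem_univ, true_and] at hi
    obtain ⟨⟨j, hj⟩, j', hj'⟩ := hi
    have h1 := (mem_cell_iff _ _ _).1 (hv j).1
    have h2 := (mem_cell_iff _ _ _).1 (hv j').1
    by_cases his : i ∈ s
    · exact not_lt.2 (h1.2.1 i his) hj
    · exact not_lt.2 (h2.2.2 i his) hj'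
  rwa [← hvτ] at this

/-- **Container lemma for halfspaces**: few sets suffice to approximate from inside the trace of
every halfspace on a finite set, up to a quarter of the points. -/
theorem exists_containers (p : α → Module.Dual ℝ (Fin D → ℝ)) (hm : (D + 1) * D ≤ m)
    (hT : (m + 2 * D + 1) ^ ((D + 1) * D) * 3 ^ (m - (D + 1) * D) < 4 ^ (m - (D + 1) * D)) :
    ∃ 𝓕 : Finset (Finset α), #𝓕 ≤ (m + 2 * D + 1) ^ (2 * D) ∧ ∀ w : Fin D → ℝ,
      ∃ A ∈ 𝓕, (∀ x ∈ A, 0 ≤ p x w) ∧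
        4 * Nat.card {x // 0 < p x w} ≤ 4 * #A + Fintype.card α := by
  classical
  rcases isEmpty_or_nonempty α with h | h
  · exact ⟨{∅}, by simpa using Nat.one_le_pow _ _ (by omega), fun w => ⟨∅, by simp, by simp, by simp⟩⟩
  obtain ⟨a, ha⟩ := exists_net p hm hT
  let F : Finset (Fin m) × (Fin D → Fin m ⊕ Option (Fin D × Bool)) → Finset α := fun c =>
    {x | ∀ v ∈ flagVerts (cellFun (p ∘ a) c.1) cellRhs (List.ofFn c.2) ∅, 0 ≤ p x v}
  refine ⟨(positiveParts (p ∘ a) ×ˢ univ).image F, ?_, fun w => ?_⟩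
  · calc _ ≤ #(positiveParts (p ∘ a) ×ˢ
          (univ : Finset (Fin D → Fin m ⊕ Option (Fin D × Bool)))) := card_image_le
      _ = #(positiveParts (p ∘ a)) * (m + 2 * D + 1) ^ D := by
          rw [card_product, card_univ]
          simp only [Fintype.card_fun, Fintype.card_fin, Fintype.card_sum, Fintype.card_option,
            Fintype.card_prod, Fintype.card_bool]
          rw [mul_comm D 2, add_assoc]
      _ ≤ (m + 2 * D + 1) ^ D * (m + 2 * D + 1) ^ D := by
          gcongr
          refine (card_positiveParts_le _).trans ?_
          rw [Module.finrank_fin_fun]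
          gcongr
          omega
      _ = _ := by rw [← pow_add, two_mul]
  -- Rescaling by `t` brings `w` into the cube and preserves all signs.
  · set t : ℝ := 1 + ∑ k, |w k| with ht
    have hsum : 0 ≤ ∑ k, |w k| := sum_nonneg fun _ _ => abs_nonneg _
    have htpos : 0 < t := by linarith
    set w' := t⁻¹ • w with hw'
    have hpw : ∀ x, p x w = t * p x w' := fun x => by
      rw [hw', map_smul, smul_eq_mul, mul_inv_cancel_left₀ htpos.ne']
    have hpos : ∀ x, 0 < p x w ↔ 0 < p x w' := fun x => by
      rw [hpw, mul_pos_iff_of_pos_left htpos]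
    set s : Finset (Fin m) := {i | 0 < (p ∘ a) i w'} with hs
    have hcell : w' ∈ face (cellFun (p ∘ a) s) cellRhs ∅ := by
      refine ⟨(mem_cell_iff _ _ _).2 ⟨fun k => ?_, fun i hi => ?_, fun i hi => ?_⟩, by simp⟩
      · have hk : |w k| ≤ ∑ k, |w k| :=
          single_le_sum (f := fun k => |w k|) (fun _ _ => abs_nonneg _) (mem_univ k)
        rw [hw', Pi.smul_apply, smul_eq_mul, abs_mul, abs_inv, abs_of_pos htpos,
          inv_mul_le_one₀ htpos]
        linarith
      · rw [hs, mem_filter] at hi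
        exact hi.2.le
      · rw [hs, mem_filter] at hi
        exact not_lt.1 fun h => hi ⟨mem_univ _, h⟩
    obtain ⟨l, hl, hne, hconv⟩ := exists_mem_convexHull_flagVerts (isCompact_cell (p ∘ a) s)
      (fun u => eq_zero_of_cellFun_nonneg (p ∘ a) s) (i₀ := .inr none) rfl rfl D ∅ w' hcell
      ((Submodule.finrank_le _).trans_eq (Module.finrank_fin_fun ℝ))
    set L := flagVerts (cellFun (p ∘ a) s) cellRhs l ∅ with hL
    have hlen : L.length = D + 1 := by rw [hL, length_flagVerts, hl]
    let v : Fin (D + 1) → Fin D → ℝ := fun j => L.get (j.cast hlen.symm)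
    have hrange : {x | x ∈ L} = Set.range v := by
      ext x
      simp only [Set.mem_ofPred_eq, List.mem_iff_get, Set.mem_range, v]
      constructor
      · rintro ⟨j, rfl⟩; exact ⟨j.cast hlen, rfl⟩
      · rintro ⟨j, rfl⟩; exact ⟨_, rfl⟩
    rw [hrange] at hconv
    have hcross := ha s v fun j => isVertex_of_mem_flagVerts (isCompact_cell (p ∘ a) s) hne
      (List.get_mem _ _)
    have hofFn : List.ofFn (fun j : Fin D => l.get (j.cast hl.symm)) = l :=
      List.ext_getElem (by simp [hl]) (by simp)
    have hF : F (s, fun j : Fin D => l.get (j.cast hl.symm)) =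
        ({x | ∀ j, 0 ≤ p x (v j)} : Finset α) := by
      ext x
      simp only [F, mem_filter, mem_univ, true_and, hofFn, ← hL]
      constructor
      · exact fun h j => h _ (List.get_mem _ _)
      · intro h u hu
        obtain ⟨j, rfl⟩ : u ∈ Set.range v := hrange ▸ hu
        exact h j
    refine ⟨_, mem_image_of_mem F (a := (s, fun j : Fin D => l.get (j.cast hl.symm)))
      (mem_product.2 ⟨?_, mem_univ _⟩), ?_, ?_⟩
    · rw [positiveParts, mem_filter]
      exact ⟨mem_univ _, w', by rw [hs]⟩
    · intro x hx
      rw [hF, mem_filter] at hx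
      rw [hpw]
      exact mul_nonneg htpos.le (nonneg_of_mem_convexHull hconv hx.2)
    · rw [hF]
      have hsub : ({x | 0 < p x w} : Finset α) ⊆
          ({x | ∀ j, 0 ≤ p x (v j)} : Finset α) ∪ crossing p v := by
        intro x hx
        simp only [mem_filter, mem_univ, true_and, mem_union, crossing] at hx ⊢
        by_contra! hcon
        exact absurd (exists_pos_of_mem_convexHull hconv ((hpos x).1 hx))
          (by push Not; exact hcon.2 hcon.1)
      have h1 := (card_le_card hsub).trans (card_union_le _ _)
      rw [Nat.card_eq_fintype_card, Fintype.card_subtype]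
      omega

end PolytopeFlag

/-! ### Composing protocols. -/

namespace CommComplexity

open Finset

namespace Protocol

variable {A B Z W : Type*}

@[simp]
theorem cost_map (φ : Z → W) (P : Protocol A B Z) : (P.map φ).cost = P.cost := by
  induction P with
  | leaf z => rfl
  | alice f p q hp hq => simp [map, cost, hp, hq]
  | bob f p q hp hq => simp [map, cost, hp, hq]

@[simp]
theorem run_map (φ : Z → W) (P : Protocol A B Z) (x : A) (y : B) :
    (P.map φ).run x y = φ (P.run x y) := by
  induction P with
  | leaf z => rfl
  | alice f p q hp hq => simp only [map, run, hp, hq]; split_ifs <;> rfl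
  | bob f p q hp hq => simp only [map, run, hp, hq]; split_ifs <;> rfl

/-- The protocol with the roles of the players exchanged. -/
def swap : Protocol A B Z → Protocol B A Z
  | leaf z => leaf z
  | alice f p q => bob f p.swap q.swap
  | bob g p q => alice g p.swap q.swap

@[simp]
theorem cost_swap (P : Protocol A B Z) : P.swap.cost = P.cost := by
  induction P with
  | leaf z => rfl
  | alice f p q hp hq => simp [swap, cost, hp, hq]
  | bob f p q hp hq => simp [swap, cost, hp, hq]

@[simp]
theorem run_swap (P : Protocol A B Z) (x : A) (y : B) : P.swap.run y x = P.run x y := by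
  induction P with
  | leaf z => rfl
  | alice f p q hp hq => simp only [swap, run, hp, hq]
  | bob f p q hp hq => simp only [swap, run, hp, hq]

theorem exists_alice_bits {k c : ℕ} (f : A → Fin k → Bool) (Q : (Fin k → Bool) → Protocol A B Z)
    (hQ : ∀ b, (Q b).cost ≤ c) :
    ∃ P : Protocol A B Z, P.cost ≤ k + c ∧ ∀ x y, P.run x y = (Q (f x)).run x y := by
  induction k with
  | zero => exact ⟨Q default, by simpa using hQ default, fun x y => by
      rw [Subsingleton.elim (f x) default]⟩
  | succ k ih =>
    choose P hc hr using fun b : Bool =>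
      ih (fun x => Fin.tail (f x)) (fun t => Q (Fin.cons b t)) fun t => hQ _
    refine ⟨alice (fun x => f x 0) (P false) (P true), ?_, fun x y => ?_⟩
    · have h1 := hc false
      have h2 := hc true
      simp only [cost]
      omega
    · have hx : (Fin.cons (f x 0) (Fin.tail (f x)) : Fin (k + 1) → Bool) = f x :=
        Fin.cons_self_tail (f x)
      conv_rhs => rw [← hx]
      cases h : f x 0 <;> simp [run, h, hr]

/-- Alice sends a message from a set of at most `2 ^ k` messages, and the parties continue with a
protocol depending on it. -/
theorem exists_alice_message {M : Type*} [Fintype M] [Nonempty M] {k c : ℕ}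
    (hM : Fintype.card M ≤ 2 ^ k) (f : A → M) (Q : M → Protocol A B Z) (hQ : ∀ b, (Q b).cost ≤ c) :
    ∃ P : Protocol A B Z, P.cost ≤ k + c ∧ ∀ x y, P.run x y = (Q (f x)).run x y := by
  obtain ⟨e⟩ : Nonempty (M ↪ (Fin k → Bool)) :=
    Function.Embedding.nonempty_of_card_le (by simpa using hM)
  obtain ⟨P, hc, hr⟩ := exists_alice_bits (fun x => e (f x)) (fun b => Q (Function.invFun e b))
    fun b => hQ _
  exact ⟨P, hc, fun x y => by rw [hr, Function.leftInverse_invFun e.injective]⟩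

/-- Bob sends a message from a set of at most `2 ^ k` messages, and the parties continue with a
protocol depending on it. -/
theorem exists_bob_message {M : Type*} [Fintype M] [Nonempty M] {k c : ℕ}
    (hM : Fintype.card M ≤ 2 ^ k) (f : B → M) (Q : M → Protocol A B Z) (hQ : ∀ b, (Q b).cost ≤ c) :
    ∃ P : Protocol A B Z, P.cost ≤ k + c ∧ ∀ x y, P.run x y = (Q (f y)).run x y := by
  obtain ⟨P, hc, hr⟩ := exists_alice_message hM f (fun b => (Q b).swap) (by simpa using hQ)
  exact ⟨P.swap, by simpa using hc, fun x y => by rw [run_swap, hr, run_swap]⟩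

end Protocol

/-! ### The round-based protocol. -/

section Rounds

variable {U : Type*}

/-- The protocol labels the points of `W` according to a separated pair, announcing `1`, and
announces `0` if the inputs have a common point in `W`. -/
def Separates (sep : Set U → Set U → Prop) (W : Finset U)
    (P : Protocol (Set U) (Set U) (Fin 2 × (U → ℤˣ))) : Prop :=
  ∀ X Y : Set U, ((∃ u ∈ W, u ∈ X ∧ u ∈ Y) → (P.run X Y).1 = 0) ∧
    (sep X Y → (P.run X Y).1 = 1 ∧
      ∀ u ∈ W, (u ∈ X → (P.run X Y).2 u = -1) ∧ (u ∈ Y → (P.run X Y).2 u = 1))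

theorem exists_separates_of_card_le_one {sep : Set U → Set U → Prop}
    (hsep : ∀ X Y, sep X Y → Disjoint X Y) {W : Finset U} (hW : #W ≤ 1) :
    ∃ P : Protocol (Set U) (Set U) (Fin 2 × (U → ℤˣ)), P.cost ≤ 2 ∧ Separates sep W P := by
  classical
  refine ⟨.alice (fun X => ∃ u ∈ W, u ∈ X) (.leaf (1, fun _ => 1))
    (.bob (fun Y => ∃ u ∈ W, u ∈ Y) (.leaf (1, fun _ => -1)) (.leaf (0, fun _ => 1))),
    by simp [Protocol.cost], fun X Y => ?_⟩
  by_cases hX : ∃ u ∈ W, u ∈ X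
  · by_cases hY : ∃ u ∈ W, u ∈ Y
    · obtain ⟨u, hu, huX⟩ := id hX
      obtain ⟨v, hv, hvY⟩ := id hY
      refine ⟨fun _ => by simp only [Protocol.run, hX, hY, decide_true, if_true], fun h => ?_⟩
      obtain rfl := Finset.card_le_one.1 hW u hu v hv
      exact absurd hvY (Set.disjoint_left.1 (hsep X Y h) huX)
    · refine ⟨fun ⟨u, hu, _, h⟩ => absurd ⟨u, hu, h⟩ hY, fun _ => ?_⟩
      simp only [Protocol.run, hX, hY, decide_true, decide_false, if_true, Bool.false_eq_true,
        if_false, true_and]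
      exact fun u hu => ⟨fun _ => trivial, fun h => absurd ⟨u, hu, h⟩ hY⟩
  · refine ⟨fun ⟨u, hu, h, _⟩ => absurd ⟨u, hu, h⟩ hX, fun _ => ?_⟩
    simp only [Protocol.run, hX, decide_false, Bool.false_eq_true, if_false, true_and]
    exact fun u hu => ⟨fun h => absurd ⟨u, hu, h⟩ hX, fun _ => trivial⟩

/-- Each round removes a set `A` of at least a quarter of `W` that misses one player's input, so no
common point is lost. The extra 1 in `k + 1` pays for the message that no such set exists. -/
theorem exists_separates {sep : Set U → Set U → Prop} (hsep : ∀ X Y, sep X Y → Disjoint X Y)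
    {k : ℕ} (hcont : ∀ W : Finset U, ∃ 𝓖 : Finset (Finset U), #𝓖 ≤ 2 ^ k ∧
      (∀ A ∈ 𝓖, A ⊆ W ∧ #W ≤ 4 * #A) ∧
      ∀ X Y, sep X Y → ∃ A ∈ 𝓖, Disjoint (A : Set U) X ∨ Disjoint (A : Set U) Y)
    (r : ℕ) (W : Finset U) (hr : #W * 3 ^ r ≤ 4 ^ r) :
    ∃ P : Protocol (Set U) (Set U) (Fin 2 × (U → ℤˣ)),
      P.cost ≤ 2 * (k + 1) * r + 2 ∧ Separates sep W P := by
  classical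
  induction r generalizing W with
  | zero => simpa using exists_separates_of_card_le_one hsep (by simpa using hr)
  | succ r ih =>
    obtain ⟨𝓖, hcard, hgood, hex⟩ := hcont W
    have hstep : ∀ A : 𝓖, #(W \ A.1) * 3 ^ r ≤ 4 ^ r := by
      intro A
      obtain ⟨h1, h2⟩ := hgood A.1 A.2
      have h3 : 4 * #(W \ A.1) ≤ 3 * #W := by
        rw [card_sdiff_of_subset h1]
        omega
      have : 4 * (#(W \ A.1) * 3 ^ r) ≤ 4 * 4 ^ r := by
        calc 4 * (#(W \ A.1) * 3 ^ r) = 4 * #(W \ A.1) * 3 ^ r := by ring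
          _ ≤ 3 * #W * 3 ^ r := by gcongr
          _ = #W * 3 ^ (r + 1) := by ring
          _ ≤ 4 ^ (r + 1) := hr
          _ = 4 * 4 ^ r := by ring
      exact Nat.le_of_mul_le_mul_left this (by norm_num)
    choose P hPc hPs using fun A : 𝓖 => ih (W \ A.1) (hstep A)
    have hmsg : ∀ X : Set U, ∃ o : Option 𝓖, (∀ A, o = some A → Disjoint (A.1 : Set U) X) ∧
        (o = none → ∀ A ∈ 𝓖, ¬ Disjoint (A : Set U) X) := by
      intro X
      by_cases h : ∃ A ∈ 𝓖, Disjoint (A : Set U) X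
      · obtain ⟨A, hA, hd⟩ := h
        exact ⟨some ⟨A, hA⟩, by rintro _ ⟨⟩; exact hd, by simp⟩
      · push Not at h
        exact ⟨none, by simp, fun _ => h⟩
    choose f hf hfnone using hmsg
    have hM : Fintype.card (Option 𝓖) ≤ 2 ^ (k + 1) := by
      rw [Fintype.card_option, Fintype.card_coe, pow_succ]
      have := Nat.one_le_two_pow (n := k)
      omega
    -- The label `e` on `A` is 1 when `A` avoids `X` and -1 when it avoids `Y`.
    let Q : ℤˣ → 𝓖 → Protocol (Set U) (Set U) (Fin 2 × (U → ℤˣ)) := fun e A =>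
      (P A).map fun z => (z.1, fun u => if u ∈ A.1 then e else z.2 u)
    have hQc : ∀ e A, (Q e A).cost ≤ 2 * (k + 1) * r + 2 := by simpa [Q] using hPc
    obtain ⟨R, hRc, hR⟩ := Protocol.exists_bob_message (A := Set U) hM f
      (fun o => o.elim (.leaf (0, fun _ => 1)) (Q (-1))) (c := 2 * (k + 1) * r + 2)
      (by rintro (_ | A); exacts [Nat.zero_le _, hQc _ A])
    obtain ⟨S, hSc, hS⟩ := Protocol.exists_alice_message (B := Set U) hM f
      (fun o => o.elim R (Q 1)) (c := (k + 1) + (2 * (k + 1) * r + 2))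
      (by rintro (_ | A); exacts [hRc, (hQc _ A).trans (Nat.le_add_left _ _)])
    refine ⟨S, hSc.trans (le_of_eq (by ring)), fun X Y => ?_⟩
    rw [hS]
    rcases hX : f X with _ | A
    · rw [Option.elim_none, hR]
      rcases hY : f Y with _ | A
      · refine ⟨fun _ => rfl, fun h => ?_⟩
        obtain ⟨A, hA, hd | hd⟩ := hex X Y h
        exacts [absurd hd (hfnone X hX A hA), absurd hd (hfnone Y hY A hA)]
      · have hd := Set.disjoint_left.1 (hf Y A hY)
        obtain ⟨h0, h1⟩ := hPs A X Y
        simp only [Option.elim_some, Q, Protocol.run_map]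
        refine ⟨fun ⟨u, hu, huX, huY⟩ =>
          h0 ⟨u, mem_sdiff.2 ⟨hu, fun h => hd h huY⟩, huX, huY⟩, fun h => ⟨(h1 h).1, fun u hu => ?_⟩⟩
        by_cases huA : u ∈ A.1
        · simp only [huA, if_true]
          exact ⟨fun _ => trivial, fun h => absurd h (hd huA)⟩
        · simp only [huA, if_false]
          exact (h1 h).2 u (mem_sdiff.2 ⟨hu, huA⟩)
    · have hd := Set.disjoint_left.1 (hf X A hX)
      obtain ⟨h0, h1⟩ := hPs A X Y
      simp only [Option.elim_some, Q, Protocol.run_map]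
      refine ⟨fun ⟨u, hu, huX, huY⟩ =>
        h0 ⟨u, mem_sdiff.2 ⟨hu, fun h => hd h huX⟩, huX, huY⟩, fun h => ⟨(h1 h).1, fun u hu => ?_⟩⟩
      by_cases huA : u ∈ A.1
      · simp only [huA, if_true]
        exact ⟨fun h => absurd h (hd huA), fun _ => trivial⟩
      · simp only [huA, if_false]
        exact (h1 h).2 u (mem_sdiff.2 ⟨hu, huA⟩)

end Rounds

end CommComplexity

/-! ### Separating hyperplanes and numerical bounds. -/

namespace CommComplexity

open Finset

variable {d : ℕ}

/-- A point of `ℝ^d` as a functional on the space of affine functions `w₀ + ∑ k, wₖ xₖ`. -/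
noncomputable def evalAffine (x : EuclideanSpace ℝ (Fin d)) :
    Module.Dual ℝ (Fin (d + 1) → ℝ) :=
  LinearMap.proj 0 + ∑ k : Fin d, x k • LinearMap.proj k.succ

theorem evalAffine_apply (x : EuclideanSpace ℝ (Fin d)) (w : Fin (d + 1) → ℝ) :
    evalAffine x w = w 0 + ∑ k : Fin d, x k * w k.succ := by
  simp [evalAffine]

theorem exists_affine_separation {U : Finset (EuclideanSpace ℝ (Fin d))} {X Y : Set U}
    (h : conv X ∩ conv Y = ∅) :
    ∃ w : Fin (d + 1) → ℝ, (∀ x ∈ X, evalAffine x.1 w < 0) ∧ (∀ y ∈ Y, 0 < evalAffine y.1 w) ∧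
      ∀ u : U, evalAffine u.1 w ≠ 0 := by
  have hc : ∀ X : Set U, IsCompact (conv X) := fun X =>
    ((Set.toFinite X).image _).isCompact_convexHull ℝ
  obtain ⟨f, s, t, hX, hst, hY⟩ := geometric_hahn_banach_compact_closed (convex_convexHull ℝ _)
    (hc X) (convex_convexHull ℝ _) (hc Y).isClosed (Set.disjoint_iff_inter_eq_empty.2 h)
  -- The threshold avoids the finitely many values of `f` on `U`, so `w` and `-w` split the points
  -- with no ties.
  obtain ⟨b, ⟨hsb, hbt⟩, hb⟩ := ((Set.Ioo_infinite hst).sdiff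
    (Set.finite_range fun u : U => f u.1)).nonempty
  have hf : ∀ x : EuclideanSpace ℝ (Fin d), f x = ∑ k, x k * f (EuclideanSpace.single k 1) := by
    intro x
    conv_lhs => rw [← (EuclideanSpace.basisFun (Fin d) ℝ).sum_repr x]
    simp [map_sum]
  have hw : ∀ x : EuclideanSpace ℝ (Fin d), evalAffine x
      (Fin.cons (-b) fun k => f (EuclideanSpace.single k 1)) = f x - b := by
    intro x
    rw [evalAffine_apply, hf x]
    simp only [Fin.cons_zero, Fin.cons_succ]
    ring
  refine ⟨Fin.cons (-b) fun k => f (EuclideanSpace.single k 1), fun x hx => ?_, fun y hy => ?_,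
    fun u hu => ?_⟩
  · rw [hw]
    have := hX x.1 (subset_convexHull ℝ _ ⟨x, hx, rfl⟩)
    linarith
  · rw [hw]
    have := hY y.1 (subset_convexHull ℝ _ ⟨y, hy, rfl⟩)
    linarith
  · rw [hw, sub_eq_zero] at hu
    exact hb ⟨u, hu⟩

theorem exists_separated_containers (U : Finset (EuclideanSpace ℝ (Fin d))) {m : ℕ}
    (hm : (d + 1 + 1) * (d + 1) ≤ m)
    (hT : (m + 2 * (d + 1) + 1) ^ ((d + 1 + 1) * (d + 1)) * 3 ^ (m - (d + 1 + 1) * (d + 1)) <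
      4 ^ (m - (d + 1 + 1) * (d + 1))) (W : Finset U) :
    ∃ 𝓖 : Finset (Finset U), #𝓖 ≤ (m + 2 * (d + 1) + 1) ^ (2 * (d + 1)) ∧
      (∀ A ∈ 𝓖, A ⊆ W ∧ #W ≤ 4 * #A) ∧ ∀ X Y : Set U, conv X ∩ conv Y = ∅ →
        ∃ A ∈ 𝓖, Disjoint (A : Set U) X ∨ Disjoint (A : Set U) Y := by
  classical
  obtain ⟨𝓕, hcard, hF⟩ := PolytopeFlag.exists_containers (α := W) (fun x => evalAffine x.1.1) hm hT
  refine ⟨{A ∈ 𝓕.image fun A => A.map (Function.Embedding.subtype _) | A ⊆ W ∧ #W ≤ 4 * #A},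
    (card_filter_le _ _).trans (card_image_le.trans hcard), fun A hA => (mem_filter.1 hA).2,
    fun X Y h => ?_⟩
  obtain ⟨w, hX, hY, h0⟩ := exists_affine_separation h
  -- At least half the points are positive at `v` and at most a quarter are lost, so the container
  -- keeps a quarter.
  have key : ∀ (v : Fin (d + 1) → ℝ) (Z : Set U), (∀ z ∈ Z, evalAffine z.1 v < 0) →
      Fintype.card W ≤ 2 * Nat.card {x : W // 0 < evalAffine x.1.1 v} →
      ∃ A ∈ ({A ∈ 𝓕.image fun A => A.map (Function.Embedding.subtype _) |
        A ⊆ W ∧ #W ≤ 4 * #A} : Finset (Finset U)), Disjoint (A : Set U) Z := by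
    intro v Z hZ hv
    obtain ⟨A, hA, hpos, hc⟩ := hF v
    refine ⟨A.map (Function.Embedding.subtype _), mem_filter.2 ⟨mem_image_of_mem _ hA, ?_, ?_⟩, ?_⟩
    · intro x hx
      obtain ⟨y, -, rfl⟩ := mem_map.1 hx
      exact y.2
    · rw [card_map]
      rw [Fintype.card_coe] at hc hv
      omega
    · rw [Set.disjoint_left]
      intro x hx hxZ
      obtain ⟨y, hy, rfl⟩ := mem_map.1 (mem_coe.1 hx)
      exact not_lt.2 (hpos y hy) (hZ _ hxZ)
  have hsum : Fintype.card W = Nat.card {x : W // 0 < evalAffine x.1.1 w} +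
      Nat.card {x : W // 0 < evalAffine x.1.1 (-w)} := by
    have hcard : ∀ v, Nat.card {x : W // 0 < evalAffine x.1.1 v} =
        #{x : W | 0 < evalAffine x.1.1 v} := fun v => by
      rw [Nat.card_eq_fintype_card, Fintype.card_subtype]
    rw [hcard, hcard, ← card_univ,
      ← card_filter_add_card_filter_not (s := univ) fun x : W => 0 < evalAffine x.1.1 w]
    congr 2
    ext x
    simp only [mem_filter, mem_univ, true_and, map_neg, neg_pos]
    exact ⟨fun h => lt_of_le_of_ne (not_lt.1 h) (h0 _), fun h => not_lt.2 h.le⟩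
  rcases le_total (Nat.card {x : W // 0 < evalAffine x.1.1 w})
    (Nat.card {x : W // 0 < evalAffine x.1.1 (-w)}) with hle | hle
  · obtain ⟨A, hA, hd⟩ := key (-w) Y (fun z hz => by simpa using hY z hz) (by omega)
    exact ⟨A, hA, Or.inr hd⟩
  · obtain ⟨A, hA, hd⟩ := key w X hX (by omega)
    exact ⟨A, hA, Or.inl hd⟩

theorem three_mul_sq_lt_two_pow (K : ℕ) : 3 * K ^ 2 + 33 * K + 1 < 2 ^ (K + 10) := by
  induction K with
  | zero => norm_num
  | succ K ih =>
    rw [show K + 1 + 10 = (K + 10) + 1 by ring, pow_succ 2]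
    rcases le_or_gt K 3 with h | h
    · interval_cases K <;> norm_num
    · have : 3 * (K + 1) ^ 2 + 33 * (K + 1) + 1 ≤ 2 * (3 * K ^ 2 + 33 * K + 1) := by nlinarith
      linarith

/-- With `m - K = 3K(K + 10)` both sides are `K`-th powers, and the bases compare through 2 · 27 <
64. -/
theorem sample_size_bound {D K m : ℕ} (hD : D ≤ K) (hm : m = K + 3 * K * (K + 10)) (hK : 0 < K) :
    (m + 2 * D + 1) ^ K * 3 ^ (m - K) < 4 ^ (m - K) := by
  have h1 : m + 2 * D + 1 < 2 ^ (K + 10) := by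
    refine lt_of_le_of_lt ?_ (three_mul_sq_lt_two_pow K)
    rw [hm]
    nlinarith
  have h2 : m - K = 3 * (K + 10) * K := by rw [hm, Nat.add_sub_cancel_left]; ring
  rw [h2, pow_mul, pow_mul _ _ K, ← mul_pow]
  refine Nat.pow_lt_pow_left ?_ hK.ne'
  calc (m + 2 * D + 1) * 3 ^ (3 * (K + 10)) < 2 ^ (K + 10) * 3 ^ (3 * (K + 10)) := by gcongr
    _ = 54 ^ (K + 10) := by rw [pow_mul, ← mul_pow]; norm_num
    _ ≤ 64 ^ (K + 10) := by gcongr; norm_num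
    _ = 4 ^ (3 * (K + 10)) := by rw [pow_mul]; norm_num

/-- The left side is at most `37 * K ^ 2`, a quartic in `d`, so naming one hyperplane costs O(log d)
bits. -/
theorem message_count_bound {d ℓ : ℕ} (hd : max d 2 ≤ 2 ^ ℓ) (hℓ : 1 ≤ ℓ) :
    (d + 1 + 1) * (d + 1) + 3 * ((d + 1 + 1) * (d + 1)) * ((d + 1 + 1) * (d + 1) + 10) +
      2 * (d + 1) + 1 ≤ 2 ^ (14 * ℓ) := by
  set K := (d + 1 + 1) * (d + 1) with hK
  have h1 : d ≤ 2 ^ ℓ := (le_max_left _ _).trans hd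
  have h2 : 2 ≤ 2 ^ ℓ := (le_max_right _ _).trans hd
  have hK2 : K ≤ 4 * (2 ^ ℓ) ^ 2 := by
    calc K ≤ (2 * 2 ^ ℓ) * (2 * 2 ^ ℓ) := Nat.mul_le_mul (by omega) (by omega)
      _ = _ := by ring
  have hDK : d + 1 ≤ K := Nat.le_mul_of_pos_left _ (by omega)
  have hK1 : 1 ≤ K := by omega
  calc K + 3 * K * (K + 10) + 2 * (d + 1) + 1 ≤ 37 * K ^ 2 := by nlinarith
    _ ≤ 64 * (4 * (2 ^ ℓ) ^ 2) ^ 2 := by gcongr; norm_num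
    _ = 2 ^ 10 * 2 ^ (4 * ℓ) := by rw [mul_pow, ← pow_mul, ← pow_mul]; norm_num; ring
    _ = 2 ^ (10 + 4 * ℓ) := (pow_add _ _ _).symm
    _ ≤ 2 ^ (14 * ℓ) := Nat.pow_le_pow_right (by norm_num) (by omega)

theorem clog_two_le_four_mul_log {x : ℕ} (hx : 2 ≤ x) : (Nat.clog 2 x : ℝ) ≤ 4 * Real.log x := by
  have hx0 : (2 : ℝ) ≤ x := by exact_mod_cast hx
  have h1 : ((2 : ℝ)) ^ (Nat.clog 2 x - 1) ≤ x := by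
    exact_mod_cast (Nat.pow_pred_clog_lt_self (by norm_num) (by omega)).le
  have h2 := Real.log_le_log (by positivity) h1
  rw [Real.log_pow] at h2
  have h3 : Real.log 2 ≤ Real.log x := Real.log_le_log (by norm_num) hx0
  have h4 : 1 ≤ Nat.clog 2 x := Nat.clog_pos (by norm_num) hx
  rw [Nat.cast_sub h4, Nat.cast_one] at h2
  have h5 := Real.log_two_gt_d9
  have h6 : (0 : ℝ) ≤ Nat.clog 2 x := Nat.cast_nonneg _
  nlinarith

/-- Three rounds more than halve the set, since (3/4)^3 < 1/2. -/
theorem card_mul_three_pow_le (n : ℕ) :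
    n * 3 ^ (3 * Nat.clog 2 (max n 2)) ≤ 4 ^ (3 * Nat.clog 2 (max n 2)) := by
  have h : n ≤ 2 ^ Nat.clog 2 (max n 2) := (le_max_left _ _).trans (Nat.le_pow_clog (by norm_num) _)
  calc n * 3 ^ (3 * Nat.clog 2 (max n 2))
      ≤ 2 ^ Nat.clog 2 (max n 2) * 3 ^ (3 * Nat.clog 2 (max n 2)) := by gcongr
    _ = 54 ^ Nat.clog 2 (max n 2) := by rw [pow_mul, ← mul_pow]; norm_num
    _ ≤ 64 ^ Nat.clog 2 (max n 2) := by gcongr; norm_num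
    _ = 4 ^ (3 * Nat.clog 2 (max n 2)) := by rw [pow_mul]; norm_num

theorem disjoint_of_conv_inter_eq_empty {U : Finset (EuclideanSpace ℝ (Fin d))} {X Y : Set U}
    (h : conv X ∩ conv Y = ∅) : Disjoint X Y := by
  rw [Set.disjoint_left]
  intro u hX hY
  have : u.1 ∈ conv X ∩ conv Y :=
    ⟨subset_convexHull ℝ _ ⟨u, hX, rfl⟩, subset_convexHull ℝ _ ⟨u, hY, rfl⟩⟩
  rw [h] at this
  exact this

theorem exists_protocol (hd : 1 ≤ d) (U : Finset (EuclideanSpace ℝ (Fin d))) :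
    ∃ P : Protocol (Set U) (Set U) (Fin 2 × (U → ℤˣ)),
      P.cost ≤ 344 * d * Nat.clog 2 (max d 2) * Nat.clog 2 (max (#U) 2) ∧
      Separates (fun X Y => conv X ∩ conv Y = ∅) univ P := by
  classical
  set ℓ := Nat.clog 2 (max d 2) with hℓ
  set s := Nat.clog 2 (max (#U) 2) with hs
  have hℓ1 : 1 ≤ ℓ := Nat.clog_pos (by norm_num) (Nat.succ_le_iff.1 (le_max_right _ _))
  have hs1 : 1 ≤ s := Nat.clog_pos (by norm_num) (Nat.succ_le_iff.1 (le_max_right _ _))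
  set K := (d + 1 + 1) * (d + 1) with hK
  have hDK : d + 1 ≤ K := Nat.le_mul_of_pos_left _ (by omega)
  have hcont := exists_separated_containers U (m := K + 3 * K * (K + 10)) (Nat.le_add_right _ _)
    (sample_size_bound hDK rfl (by omega))
  obtain ⟨P, hc, hP⟩ := exists_separates (sep := fun X Y : Set U => conv X ∩ conv Y = ∅)
    (fun X Y h => disjoint_of_conv_inter_eq_empty h) (k := 14 * ℓ * (2 * (d + 1)))
    (fun W => by
      obtain ⟨𝓖, h1, h2⟩ := hcont W
      refine ⟨𝓖, h1.trans ?_, h2⟩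
      rw [pow_mul 2]
      exact Nat.pow_le_pow_left
        (message_count_bound (Nat.le_pow_clog (by norm_num) _) hℓ1) _)
    (3 * s) univ (by
      rw [card_univ, Fintype.card_coe]
      exact card_mul_three_pow_le _)
  refine ⟨P, hc.trans ?_, hP⟩
  have hdl : 1 ≤ d * ℓ := Nat.mul_pos hd hℓ1
  have hdls : 1 ≤ d * ℓ * s := Nat.mul_pos hdl hs1
  have h1 : 14 * ℓ * (2 * (d + 1)) + 1 ≤ 57 * (d * ℓ) := by nlinarith
  calc 2 * (14 * ℓ * (2 * (d + 1)) + 1) * (3 * s) + 2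
      ≤ 2 * (57 * (d * ℓ)) * (3 * s) + 2 * (d * ℓ * s) := by gcongr; omega
    _ = 344 * d * ℓ * s := by ring

end CommComplexity

theorem mainTheorem3 :
    ∃ C : ℝ, 0 < C ∧ ∀ d : ℕ, 1 ≤ d → ∀ U : Finset (EuclideanSpace ℝ (Fin d)),
      ∃ P : CommComplexity.Protocol (Set U) (Set U) (Fin 2 × (U → ℤˣ)),
        (P.cost : ℝ) ≤ C * d * Real.log (max (d : ℝ) 2) * Real.log (max (U.card : ℝ) 2) ∧
        (P.map Prod.fst).Computes (CommComplexity.promiseCSD U) ∧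
        CommComplexity.detCC (CommComplexity.promiseCSD U) ≤ (P.cost : ℕ∞) ∧
        ∀ X Y : Set U, CommComplexity.conv X ∩ CommComplexity.conv Y = ∅ →
          X ⊆ (P.run X Y).2 ⁻¹' {-1} ∧ Y ⊆ (P.run X Y).2 ⁻¹' {1} := by
  -- 5504 = 344 · 4 · 4, with one factor 4 for each conversion from `Nat.clog 2` to `Real.log`.
  refine ⟨5504, by norm_num, fun d hd U => ?_⟩
  obtain ⟨P, hc, hP⟩ := CommComplexity.exists_protocol hd U
  have hcomp : (P.map Prod.fst).Computes (CommComplexity.promiseCSD U) := by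
    intro X Y z hz
    rw [CommComplexity.Protocol.run_map]
    unfold CommComplexity.promiseCSD at hz
    split_ifs at hz with h1 h2
    · obtain ⟨u, hX, hY⟩ := h1
      rw [← Option.some_injective _ hz]
      exact (hP X Y).1 ⟨u, Finset.mem_univ _, hX, hY⟩
    · rw [← Option.some_injective _ hz]
      exact ((hP X Y).2 h2).1
  refine ⟨P, ?_, hcomp, ?_, fun X Y h => ?_⟩
  · have h1 := CommComplexity.clog_two_le_four_mul_log (le_max_right d 2)
    have h2 := CommComplexity.clog_two_le_four_mul_log (le_max_right U.card 2)
    push_cast at h1 h2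
    calc (P.cost : ℝ) ≤ 344 * d * Nat.clog 2 (max d 2) * Nat.clog 2 (max U.card 2) := by
          exact_mod_cast hc
      _ ≤ 344 * d * (4 * Real.log (max (d : ℝ) 2)) * (4 * Real.log (max (U.card : ℝ) 2)) := by
          have h3 : 0 ≤ Real.log (max (d : ℝ) 2) :=
            Real.log_nonneg ((by norm_num : (1 : ℝ) ≤ 2).trans (le_max_right _ _))
          gcongr
      _ = _ := by ring
  · refine (iInf₂_le (P.map Prod.fst) hcomp).trans ?_
    rw [CommComplexity.Protocol.cost_map]
  · have := ((hP X Y).2 h).2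
    exact ⟨fun u hu => (this u (Finset.mem_univ _)).1 hu,
      fun u hu => (this u (Finset.mem_univ _)).2 hu⟩
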